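/- Notation. Write $\mathbb{Z}_2^{2n}$ for the vectors $(a,b)$ with $a,b\in\mathbb{Z}_2^n$, with the symplectic inner product $(a_1,b_1)\odot(a_2,b_2)=a_1\cdot b_2+a_2\cdot b_1$. A matrix over $\mathbb{Z}_2$ with $2n$ rows is isotropic if its columns are pairwise orthogonal with respect to $\odot$. For $p\in(0,1)$, $\mathcal{D}_p^{\otimes n}$ denotes the depolarizing distribution on $\mathbb{Z}_2^{2n}$: the pairs $(e_i,e_{i+n})$, $1\le i\le n$, are independent, each equal to $(0,0)$ with probability $1-p$ and to each of the other three values with probability $p/3$. $|v|$ is the Hamming weight of $v$. A function $\nu$ is negligible, $\nu=\mathrm{negl}(n)$, if $n^k\nu(n)\to 0$ for every $k$. Theorem. Let $m=m(n)=\mathrm{poly}(n)$ (that is, $m=O(n^k)$ for some $k$) with $m>cn$ for some constant $c>1$ and all sufficiently large $n$, and let $p=p(n)\in(0,1)$ with $p=\omega(1/n)$. For each $n$ let $\mathbf{A}\in\mathbb{Z}_2^{2n\times n}$ be a uniformly random full-rank isotropic matrix, and let $\mathbf{B}\in\mathbb{Z}_2^{m\times 2n}$ be a random matrix, independent of $\mathbf{A}$,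 such that the total variation distance between the law of $\mathbf{B}\mathbf{A}$ and the uniform distribution on $\mathbb{Z}_2^{m\times n}$ is negligible in $n$. Fix any constant $\delta>0$ and let $r:=n/m$. Then $$\Pr_{\mathbf{B}}\left[\ \mathop{\mathbb{E}}_{\mathbf{e}\sim\mathcal{D}_p^{\otimes n}}\big[\,|\mathbf{B}\mathbf{e}|\,\big]\ \ge\ \Big(\frac{1-r-\delta}{2}\Big)m\ \right]\ \ge\ 1-\mathrm{negl}(n).$$ -/

import Mathlib

open Filter Asymptotics
open scoped Matrix

noncomputable section

namespace SympLPN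

/-- Vectors of `𝔽₂^{2n}`, split into two halves: the entry in position `j` is `v (inl j)` and the
entry in position `j + n` is `v (inr j)`. -/
abbrev SympVec (n : ℕ) : Type := Fin n ⊕ Fin n → ZMod 2

/-- The symplectic inner product `(a₁, b₁) ⊙ (a₂, b₂) = a₁ · b₂ + a₂ · b₁` on `𝔽₂^{2n}`. -/
def sympInner {n : ℕ} (v w : SympVec n) : ZMod 2 :=
  ∑ j, (v (Sum.inl j) * w (Sum.inr j) + w (Sum.inl j) * v (Sum.inr j))

/-- A `2n × k` matrix is isotropic if its columns are pairwise symplectically orthogonal. -/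
def IsIsotropic {n k : ℕ} (A : Matrix (Fin n ⊕ Fin n) (Fin k) (ZMod 2)) : Prop :=
  ∀ i j : Fin k, sympInner (fun t => A t i) (fun t => A t j) = 0

/-- The set of full-rank isotropic `2n × n` matrices over `𝔽₂`. -/
def fullRankIsotropic (n : ℕ) : Set (Matrix (Fin n ⊕ Fin n) (Fin n) (ZMod 2)) :=
  {A | A.rank = n ∧ IsIsotropic A}

instance (n : ℕ) : Nonempty (fullRankIsotropic n) := by
  refine ⟨⟨Matrix.fromRows 1 0, ?_, ?_⟩⟩
  · apply le_antisymm
    · simpa using Matrix.rank_le_card_width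
        (Matrix.fromRows (1 : Matrix (Fin n) (Fin n) (ZMod 2)) (0 : Matrix (Fin n) (Fin n) (ZMod 2)))
    · have h := Matrix.rank_mul_le_right
        (Matrix.fromCols (1 : Matrix (Fin n) (Fin n) (ZMod 2)) (0 : Matrix (Fin n) (Fin n) (ZMod 2)))
        (Matrix.fromRows (1 : Matrix (Fin n) (Fin n) (ZMod 2)) (0 : Matrix (Fin n) (Fin n) (ZMod 2)))
      simpa [Matrix.fromCols_mul_fromRows] using h
  · intro i j
    simp [sympInner]

instance (n : ℕ) : Finite (fullRankIsotropic n) := Subtype.finite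

instance (n : ℕ) : Fintype (fullRankIsotropic n) := Fintype.ofFinite _

/-- The uniform distribution on full-rank isotropic `2n × n` matrices. -/
def randomIsotropic (n : ℕ) : PMF (Matrix (Fin n ⊕ Fin n) (Fin n) (ZMod 2)) :=
  (PMF.uniformOfFintype (fullRankIsotropic n)).map Subtype.val

/-- The law of `B * A`, where `B` has law `P` and `A` is, independently of `B`, a uniformly random
full-rank isotropic matrix. -/
def productLaw {m n : ℕ} (P : PMF (Matrix (Fin m) (Fin n ⊕ Fin n) (ZMod 2))) :
    PMF (Matrix (Fin m) (Fin n) (ZMod 2)) :=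
  P.bind fun B => (randomIsotropic n).map fun A => B * A

/-- Total variation distance of two distributions on a finite type. -/
def tvDist {α : Type*} [Fintype α] (P Q : PMF α) : ℝ :=
  (1 / 2) * ∑ x, |(P x).toReal - (Q x).toReal|

/-- Probability of an event under a distribution. -/
def prob {α : Type*} (P : PMF α) (E : Set α) : ℝ :=
  (P.toOuterMeasure E).toReal

/-- A negligible function: `n ^ k * f n → 0` for every `k`. -/
def Negligible (f : ℕ → ℝ) : Prop :=
  SuperpolynomialDecay atTop (fun n : ℕ => (n : ℝ)) f

/-- The probability that `n`-qubit depolarizing noise with parameter `p` equals `e`: independently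
for each `j`, the pair `(e_j, e_{j+n})` is `(0, 0)` with probability `1 - p` and each of the other
three pairs with probability `p / 3`. -/
def depolarizingMass {n : ℕ} (p : ℝ) (e : SympVec n) : ℝ :=
  ∏ j, if e (Sum.inl j) = 0 ∧ e (Sum.inr j) = 0 then 1 - p else p / 3

/-- The expected Hamming weight of `B e` for depolarizing noise `e` with parameter `p`. -/
def expectedWeight {m n : ℕ} (p : ℝ) (B : Matrix (Fin m) (Fin n ⊕ Fin n) (ZMod 2)) : ℝ :=
  ∑ e : SympVec n, depolarizingMass p e * (hammingNorm (B *ᵥ e) : ℝ)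

end SympLPN

end

/-! By Fourier analysis, a row `b` of `B` contributes `(1 - (1 - 4p/3)^w)/2` to the expected weight,
where `w` is its symplectic weight. Since `p = ω(1/n)`, rows with `w ≥ εn` contribute nearly `1/2`.
A small expected weight thus forces at least `n + 2u` rows of weight below `εn`, with `u ≈ δm/4`
(`card_lowWeight_of_expectedWeight_lt`).

Such a `B` makes `B * A` atypical. Let `B'` consist of `k ≥ n + 2u` low-weight rows. If `B'` has
rank at most `k - u`, the columns of `B' * A` lie in a small space. Otherwise `G = B' Ω B'ᵀ`, with
`Ω` the symplectic form, has rank at least `2u`. As the annihilator of a Lagrangian is Lagrangian,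
the left kernel of `B' * A`, of dimension at least `k - n ≥ 2u`, is totally isotropic for `G`. Few
matrices have this property (`card_mul_fullRankIsotropic_le`).

A union bound over low-weight rows costs only `exp(δ²nm/128 + O(m))`, while the saving is at least
about `exp(δ²nm/64)`. So a uniform matrix is of this form with probability at most `2 exp(-n)`;
total variation closeness transfers this to `B * A`. -/

namespace SympLPN

/-! ### Counting matrices over the two-element field by rank -/

section Counting

open Module

variable {ι κ σ : Type*} [Fintype ι] [Fintype κ] [Fintype σ]

/-- Transposition as an equivalence. -/
def transposeEquiv (α β : Type*) : Matrix α β (ZMod 2) ≃ Matrix β α (ZMod 2) :=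
  ⟨Matrix.transpose, Matrix.transpose, fun _ => rfl, fun _ => rfl⟩

omit [Fintype ι] in
theorem finrank_ker_mulVecLin (C : Matrix ι κ (ZMod 2)) :
    finrank (ZMod 2) (LinearMap.ker C.mulVecLin) = Fintype.card κ - C.rank := by
  have h := LinearMap.finrank_range_add_finrank_ker C.mulVecLin
  rw [finrank_fintype_fun_eq_card] at h
  rw [Matrix.rank]
  omega

omit [Fintype ι] in
theorem card_mul_eq_zero (C : Matrix ι κ (ZMod 2)) :
    Nat.card {Y : Matrix κ σ (ZMod 2) // C * Y = 0} =
      2 ^ (Fintype.card σ * (Fintype.card κ - C.rank)) := by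
  have e : {Y : Matrix κ σ (ZMod 2) // C * Y = 0} ≃ (σ → LinearMap.ker C.mulVecLin) :=
    { toFun := fun Y s => ⟨fun t => Y.1 t s, by
        have := Y.2
        ext i
        exact congrFun (congrFun this i) s⟩
      invFun := fun f => ⟨fun t s => (f s).1 t, by
        ext i s
        exact congrFun (LinearMap.mem_ker.1 (f s).2) i⟩
      left_inv := fun Y => rfl
      right_inv := fun f => rfl }
  rw [Nat.card_congr e, Nat.card_fun, Module.natCard_eq_pow_finrank (K := ZMod 2),
    finrank_ker_mulVecLin, Nat.card_zmod, Nat.card_eq_fintype_card, ← pow_mul, mul_comm]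

-- The solution set is empty or a coset of the solutions of the homogeneous equation.
omit [Fintype ι] in
theorem card_mul_eq_le (C : Matrix ι κ (ZMod 2)) (D : Matrix ι σ (ZMod 2)) :
    Nat.card {Y : Matrix κ σ (ZMod 2) // C * Y = D} ≤
      2 ^ (Fintype.card σ * (Fintype.card κ - C.rank)) := by
  rcases isEmpty_or_nonempty {Y : Matrix κ σ (ZMod 2) // C * Y = D} with h | ⟨⟨Y₀, h₀⟩⟩
  · simp
  · rw [← card_mul_eq_zero]
    refine Nat.card_le_card_of_injective
      (fun Y => (⟨Y.1 - Y₀, by rw [Matrix.mul_sub, Y.2, h₀, sub_self]⟩ :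
        {Y : Matrix κ σ (ZMod 2) // C * Y = 0})) ?_
    intro Y Z h
    simpa [Subtype.ext_iff] using h

theorem card_mul_left_eq_le (C : Matrix ι κ (ZMod 2)) (D : Matrix σ κ (ZMod 2)) :
    Nat.card {Y : Matrix σ ι (ZMod 2) // Y * C = D} ≤
      2 ^ (Fintype.card σ * (Fintype.card ι - C.rank)) := by
  rw [← Matrix.rank_transpose C]
  refine le_trans (le_of_eq ?_) (card_mul_eq_le Cᵀ Dᵀ)
  refine Nat.card_congr (Equiv.subtypeEquiv (transposeEquiv σ ι) ?_)
  intro Y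
  change Y * C = D ↔ Cᵀ * Yᵀ = Dᵀ
  rw [← Matrix.transpose_mul, Matrix.transpose_inj]

/-- Matrices of the form `C * Y` lie in a set of size `2 ^ (|σ| * rank C)`. -/
theorem card_range_mul_le (C : Matrix ι κ (ZMod 2)) :
    Nat.card {M : Matrix ι σ (ZMod 2) // ∃ Y : Matrix κ σ (ZMod 2), M = C * Y} ≤
      2 ^ (Fintype.card σ * C.rank) := by
  have hc : Nat.card (σ → LinearMap.range C.mulVecLin) = 2 ^ (Fintype.card σ * C.rank) := by
    rw [Nat.card_fun, Module.natCard_eq_pow_finrank (K := ZMod 2), Nat.card_zmod,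
      Nat.card_eq_fintype_card, ← pow_mul, mul_comm, Matrix.rank]
  rw [← hc]
  refine Nat.card_le_card_of_injective (fun M s => ⟨fun i => M.1 i s, ?_⟩) ?_
  · obtain ⟨Y, hY⟩ := M.2
    refine ⟨fun t => Y t s, ?_⟩
    rw [hY]
    rfl
  · intro M N h
    ext i s
    exact congrFun (congrArg Subtype.val (congrFun h s)) i

theorem card_range_mul_left_le (C : Matrix ι κ (ZMod 2)) :
    Nat.card {M : Matrix σ κ (ZMod 2) // ∃ Y : Matrix σ ι (ZMod 2), M = Y * C} ≤
      2 ^ (Fintype.card σ * C.rank) := by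
  rw [← Matrix.rank_transpose C]
  refine le_trans (le_of_eq ?_) (card_range_mul_le (σ := σ) Cᵀ)
  refine Nat.card_congr (Equiv.subtypeEquiv (transposeEquiv σ κ) ?_)
  intro M
  change (∃ Y : Matrix σ ι (ZMod 2), M = Y * C) ↔ ∃ Y : Matrix ι σ (ZMod 2), Mᵀ = Cᵀ * Y
  constructor
  · rintro ⟨Y, rfl⟩
    exact ⟨Yᵀ, Matrix.transpose_mul _ _⟩
  · rintro ⟨Y, h⟩
    exact ⟨Yᵀ, Matrix.transpose_injective (by
      rw [h, Matrix.transpose_mul, Matrix.transpose_transpose])⟩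

/-- A matrix of rank at most `r` factors through `r` combinations of its rows. -/
theorem exists_eq_mul_mul_of_rank_le (X : Matrix σ κ (ZMod 2)) {r : ℕ} (h : X.rank ≤ r) :
    ∃ (P : Matrix σ (Fin r) (ZMod 2)) (Z : Matrix (Fin r) σ (ZMod 2)), X = P * (Z * X) := by
  classical
  set U := LinearMap.range X.vecMulLinear with hU
  have hd : finrank (ZMod 2) U ≤ r := by
    have := X.rank_transpose
    rw [Matrix.rank, Matrix.mulVecLin_transpose] at this
    exact this.trans_le h
  let b := Module.finBasis (ZMod 2) U
  have hrow : ∀ i, X i ∈ U := fun i => ⟨Pi.single i 1, by simp [Matrix.row_def]⟩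
  have hb : ∀ j, ∃ z : σ → ZMod 2, z ᵥ* X = (b j : κ → ZMod 2) := fun j => (b j).2
  choose z hz using hb
  -- `Z` produces a basis of the row space from the rows of `X`, and `P` holds the coordinates of
  -- the rows in that basis; both are padded with zeros up to size `r`.
  refine ⟨Matrix.of fun i j => if hj : j.1 < finrank (ZMod 2) U then
      b.repr ⟨X i, hrow i⟩ ⟨j.1, hj⟩ else 0,
    Matrix.of fun j => if hj : j.1 < finrank (ZMod 2) U then z ⟨j.1, hj⟩ else 0, ?_⟩
  ext i t
  have h1 := congrFun (congrArg Subtype.val (b.sum_repr ⟨X i, hrow i⟩)) t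
  simp only [Submodule.coe_sum, Submodule.coe_smul, Finset.sum_apply, Pi.smul_apply,
    smul_eq_mul] at h1
  rw [← h1, Matrix.mul_apply]
  refine Finset.sum_of_injOn (Fin.castLE hd) (Fin.castLE_injective hd).injOn (by simp) ?_ ?_
  · intro j _ hj
    rw [Matrix.of_apply, dif_neg, zero_mul]
    intro hlt
    exact hj ⟨⟨j.1, hlt⟩, by simp, by ext; simp⟩
  · intro j _
    have : (Matrix.of (fun j : Fin r => if hj : j.1 < finrank (ZMod 2) U then z ⟨j.1, hj⟩ else 0) :
        Matrix (Fin r) σ (ZMod 2)).row (Fin.castLE hd j) = z j := by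
      ext
      simp
    rw [Matrix.mul_apply_eq_vecMul]
    change _ = _ * (Matrix.row _ _ ᵥ* X) t
    rw [this, hz]
    simp

/-- The number of matrices `Y` for which `Y * C` has rank at most `r`. -/
theorem card_rank_mul_le (C : Matrix ι κ (ZMod 2)) (r : ℕ) :
    Nat.card {Y : Matrix σ ι (ZMod 2) // (Y * C).rank ≤ r} ≤
      2 ^ (Fintype.card σ * r + r * C.rank + Fintype.card σ * (Fintype.card ι - C.rank)) := by
  classical
  -- Write `Y * C = P * W` with the `r` rows of `W` in the row space of `C`. The three exponents
  -- count `P`, `W`, and the `Y` in one fibre of right multiplication by `C`.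
  let I := Matrix σ (Fin r) (ZMod 2) ×
    {W : Matrix (Fin r) κ (ZMod 2) // ∃ Y : Matrix (Fin r) ι (ZMod 2), W = Y * C}
  let T : I → Type _ := fun i => {Y : Matrix σ ι (ZMod 2) // Y * C = i.1 * i.2.1}
  have : Fintype I := Fintype.ofFinite I
  have hex : ∀ Y : {Y : Matrix σ ι (ZMod 2) // (Y * C).rank ≤ r}, ∃ i : I,
      Y.1 * C = i.1 * i.2.1 := by
    intro Y
    obtain ⟨P, Z, h⟩ := exists_eq_mul_mul_of_rank_le _ Y.2
    exact ⟨(P, ⟨Z * (Y.1 * C), Z * Y.1, by rw [Matrix.mul_assoc]⟩), h⟩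
  choose f hf using hex
  have hinj : Function.Injective (fun Y => (⟨f Y, Y.1, hf Y⟩ : Σ i, T i)) := by
    intro Y Z h
    have : (fun x : Σ i, T i => x.2.1) ⟨f Y, Y.1, hf Y⟩ =
      (fun x : Σ i, T i => x.2.1) ⟨f Z, Z.1, hf Z⟩ := by
      rw [show (⟨f Y, Y.1, hf Y⟩ : Σ i, T i) = ⟨f Z, Z.1, hf Z⟩ from h]
    exact Subtype.ext this
  refine (Nat.card_le_card_of_injective _ hinj).trans ?_
  rw [Nat.card_sigma]
  refine (Finset.sum_le_card_nsmul _ _ _ fun i _ => card_mul_left_eq_le C _).trans ?_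
  rw [smul_eq_mul, pow_add, Finset.card_univ, ← Nat.card_eq_fintype_card, Nat.card_prod, pow_add]
  gcongr
  · simp [Matrix, pow_mul, mul_comm]
  · simpa using card_range_mul_left_le (σ := Fin r) C

omit [Fintype ι] in
/-- Sylvester's rank inequality. -/
theorem rank_add_rank_le_rank_mul_add (C : Matrix ι κ (ZMod 2)) (D : Matrix κ σ (ZMod 2)) :
    C.rank + D.rank ≤ (C * D).rank + Fintype.card κ := by
  have h := LinearMap.finrank_range_add_finrank_ker
    (C.mulVecLin.domRestrict (LinearMap.range D.mulVecLin))
  have h1 : finrank (ZMod 2) (LinearMap.range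
      (C.mulVecLin.domRestrict (LinearMap.range D.mulVecLin))) = (C * D).rank := by
    rw [LinearMap.range_domRestrict, ← LinearMap.range_comp, ← Matrix.mulVecLin_mul, Matrix.rank]
  have h2 : finrank (ZMod 2) (LinearMap.ker
      (C.mulVecLin.domRestrict (LinearMap.range D.mulVecLin))) ≤
      finrank (ZMod 2) (LinearMap.ker C.mulVecLin) := by
    refine LinearMap.finrank_le_finrank_of_injective
      (f := ((LinearMap.range D.mulVecLin).subtype).restrict
        (p := LinearMap.ker (C.mulVecLin.domRestrict (LinearMap.range D.mulVecLin)))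
        (q := LinearMap.ker C.mulVecLin) ?_) ?_
    · intro x hx
      simpa using hx
    · intro x y hxy
      have := congrArg Subtype.val hxy
      exact Subtype.ext (Subtype.ext this)
  rw [finrank_ker_mulVecLin] at h2
  have h3 := C.rank_le_card_width
  have h4 : finrank (ZMod 2) (LinearMap.range D.mulVecLin) = D.rank := rfl
  omega

/-- The number of pairs `(Y, Z)` with `Y * G * Zᵀ = 0` for a matrix `G` of large rank. -/
theorem card_pairs_le (G : Matrix ι ι (ZMod 2)) (s : ℕ) (hs : 2 * s ≤ G.rank) :
    Nat.card {x : Matrix (Fin s) ι (ZMod 2) × Matrix (Fin s) ι (ZMod 2) //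
      x.1 * G * x.2ᵀ = 0} * 2 ^ (s * s / 2) ≤ 2 ^ (2 * s * Fintype.card ι + 1) := by
  classical
  set k := Fintype.card ι with hk
  set r := s / 2 with hr
  have hg : G.rank ≤ k := G.rank_le_card_width
  have e : {x : Matrix (Fin s) ι (ZMod 2) × Matrix (Fin s) ι (ZMod 2) // x.1 * G * x.2ᵀ = 0} ≃
      Σ Y : Matrix (Fin s) ι (ZMod 2), {Z : Matrix ι (Fin s) (ZMod 2) // Y * G * Z = 0} :=
    { toFun := fun x => ⟨x.1.1, x.1.2ᵀ, x.2⟩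
      invFun := fun x => ⟨(x.1, x.2.1ᵀ), x.2.2⟩
      left_inv := fun _ => rfl
      right_inv := fun _ => rfl }
  rw [Nat.card_congr e, Nat.card_sigma]
  simp only [card_mul_eq_zero, Fintype.card_fin]
  -- Split at rank `r = s / 2`: above it, few `Z` satisfy the equation; at or below it, every `Z` is
  -- allowed but such `Y` are rare.
  have h1 : ∀ Y : Matrix (Fin s) ι (ZMod 2), 2 ^ (s * (k - (Y * G).rank)) ≤
      (if (Y * G).rank ≤ r then 2 ^ (s * k) else 0) + 2 ^ (s * (k - (r + 1))) := by
    intro Y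
    split_ifs with h
    · exact le_add_right (Nat.pow_le_pow_right two_pos (by gcongr; omega))
    · rw [zero_add]
      exact Nat.pow_le_pow_right two_pos (by gcongr; omega)
  have h2 : ∑ Y : Matrix (Fin s) ι (ZMod 2), 2 ^ (s * (k - (Y * G).rank)) ≤
      2 ^ (s * r + r * G.rank + s * (k - G.rank)) * 2 ^ (s * k) +
        2 ^ (s * k) * 2 ^ (s * (k - (r + 1))) := by
    refine (Finset.sum_le_sum fun Y _ => h1 Y).trans ?_
    rw [Finset.sum_add_distrib, ← Finset.sum_filter, Finset.sum_const, Finset.sum_const,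
      smul_eq_mul, smul_eq_mul]
    gcongr
    · refine le_trans (le_of_eq ?_) (card_rank_mul_le (σ := Fin s) G r) |>.trans (by simp [hk])
      rw [Nat.card_eq_fintype_card, Fintype.card_subtype]
    · rw [Finset.card_univ, ← Nat.card_eq_fintype_card]
      simp [Matrix, ← pow_mul, hk, mul_comm]
  refine (Nat.mul_le_mul_right _ h2).trans ?_
  -- The `+ 1` in the exponent pays for the two summands. The first needs `s * r + r * g + s² / 2 ≤
  -- s * g` for `g = G.rank`, which holds as `r ≤ s / 2` and `g ≥ 2 * s`; the second needs `s² / 2 ≤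
  -- s * (r + 1)`.
  rw [add_mul, pow_succ, mul_two]
  obtain ⟨d, hd⟩ := Nat.exists_eq_add_of_le hg
  obtain ⟨a, ha⟩ := Nat.exists_eq_add_of_le hs
  have hkd : k - G.rank = d := by omega
  have h2r : 2 * r ≤ s := by omega
  have h2r' : s ≤ 2 * r + 1 := by omega
  gcongr ?_ + ?_
  · rw [← pow_add, ← pow_add]
    apply Nat.pow_le_pow_right two_pos
    rw [hkd, hd, ha]
    have : s * s / 2 * 2 ≤ s * s := Nat.div_mul_le_self _ _
    nlinarith
  · rw [← pow_add, ← pow_add]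
    apply Nat.pow_le_pow_right two_pos
    rcases Nat.eq_zero_or_pos s with h0 | h0
    · simp [h0]
    · obtain ⟨b, hb⟩ := Nat.exists_eq_add_of_le (show r + 1 ≤ k by omega)
      have hkb : k - (r + 1) = b := by omega
      rw [hkb, hb]
      have : s * s / 2 * 2 ≤ s * s := Nat.div_mul_le_self _ _
      nlinarith

end Counting

/-! ### Lagrangian subspaces and the number of products `B * A` -/

section Isotropic

open Module

variable {n : ℕ}

/-- The matrix of the symplectic inner product. -/
def sympMatrix (n : ℕ) : Matrix (Fin n ⊕ Fin n) (Fin n ⊕ Fin n) (ZMod 2) :=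
  Matrix.fromBlocks 0 1 1 0

theorem sympMatrix_mul_self : sympMatrix n * sympMatrix n = 1 := by
  simp [sympMatrix, Matrix.fromBlocks_multiply, Matrix.fromBlocks_one]

theorem sympMatrix_transpose : (sympMatrix n)ᵀ = sympMatrix n := by
  simp [sympMatrix, Matrix.fromBlocks_transpose]

theorem isUnit_det_sympMatrix : IsUnit (sympMatrix n).det :=
  Matrix.isUnit_det_of_left_inverse sympMatrix_mul_self

theorem dotProduct_sympMatrix_mulVec (v w : SympVec n) :
    v ⬝ᵥ sympMatrix n *ᵥ w = sympInner v w := by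
  simp [sympMatrix, sympInner, Matrix.fromBlocks_mulVec, dotProduct, Fintype.sum_sum_type,
    Finset.sum_add_distrib, mul_comm, add_comm]

theorem IsIsotropic.transpose_mul_mul {k : ℕ} {A : Matrix (Fin n ⊕ Fin n) (Fin k) (ZMod 2)}
    (hA : IsIsotropic A) : Aᵀ * (sympMatrix n * A) = 0 := by
  ext i j
  rw [Matrix.zero_apply, ← hA i j, ← dotProduct_sympMatrix_mulVec]
  rfl

/-- The annihilator of a full-rank isotropic matrix is isotropic. -/
theorem dotProduct_eq_zero_of_mem_fullRankIsotropic
    {A : Matrix (Fin n ⊕ Fin n) (Fin n) (ZMod 2)} (hA : A ∈ fullRankIsotropic n)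
    {v w : SympVec n} (hv : v ᵥ* A = 0) (hw : w ᵥ* A = 0) : v ⬝ᵥ sympMatrix n *ᵥ w = 0 := by
  have hle : LinearMap.range (sympMatrix n * A).mulVecLin ≤ LinearMap.ker Aᵀ.mulVecLin := by
    rintro _ ⟨x, rfl⟩
    rw [LinearMap.mem_ker, Matrix.mulVecLin_apply, Matrix.mulVecLin_apply, Matrix.mulVec_mulVec,
      hA.2.transpose_mul_mul, Matrix.zero_mulVec]
  -- Isotropy gives the inclusion and both sides have dimension `n`. The annihilator is thus the
  -- image of the column space under the symplectic matrix, an involution that preserves the form.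
  have heq : LinearMap.range (sympMatrix n * A).mulVecLin = LinearMap.ker Aᵀ.mulVecLin := by
    refine Submodule.eq_of_le_of_finrank_eq hle ?_
    rw [finrank_ker_mulVecLin, Matrix.rank_transpose, hA.1]
    change (sympMatrix n * A).rank = _
    rw [Matrix.rank_mul_eq_right_of_isUnit_det _ _ isUnit_det_sympMatrix, hA.1]
    simp
  have key : ∀ u : SympVec n, u ᵥ* A = 0 → ∃ x, u = (sympMatrix n * A) *ᵥ x := by
    intro u hu
    have : u ∈ LinearMap.range (sympMatrix n * A).mulVecLin := by
      rw [heq, LinearMap.mem_ker, Matrix.mulVecLin_apply, Matrix.mulVec_transpose, hu]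
    obtain ⟨x, hx⟩ := this
    exact ⟨x, hx.symm⟩
  obtain ⟨x, rfl⟩ := key v hv
  obtain ⟨y, rfl⟩ := key w hw
  rw [Matrix.mulVec_mulVec, ← Matrix.mul_assoc, sympMatrix_mul_self, Matrix.one_mul,
    dotProduct_comm, ← Matrix.dotProduct_transpose_mulVec, Matrix.mulVec_mulVec,
    Matrix.transpose_mul, sympMatrix_transpose, Matrix.mul_assoc, hA.2.transpose_mul_mul,
    Matrix.zero_mulVec, dotProduct_zero]

variable {ι σ : Type*} [Fintype ι] [Fintype σ]

omit [Fintype σ] in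
theorem mul_mul_transpose_eq_zero (B : Matrix ι (Fin n ⊕ Fin n) (ZMod 2))
    {A : Matrix (Fin n ⊕ Fin n) (Fin n) (ZMod 2)} (hA : A ∈ fullRankIsotropic n)
    {L₁ L₂ : Matrix σ ι (ZMod 2)} (h₁ : L₁ * (B * A) = 0) (h₂ : L₂ * (B * A) = 0) :
    L₁ * (B * sympMatrix n * Bᵀ) * L₂ᵀ = 0 := by
  have h : L₁ * (B * sympMatrix n * Bᵀ) * L₂ᵀ = (L₁ * B) * (sympMatrix n * (L₂ * B)ᵀ) := by
    simp only [Matrix.transpose_mul, Matrix.mul_assoc]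
  rw [h]
  rw [← Matrix.mul_assoc] at h₁ h₂
  ext i j
  exact dotProduct_eq_zero_of_mem_fullRankIsotropic hA (congrFun h₁ i) (congrFun h₂ j)

theorem card_subtype_le_of_imp {α : Type*} [Finite α] {p q : α → Prop} (h : ∀ x, p x → q x) :
    Nat.card {x // p x} ≤ Nat.card {x // q x} :=
  Nat.card_le_card_of_injective _ (Subtype.map_injective h Function.injective_id)

/-- Each new vector avoids a span of at most `2 ^ d` elements in a space of at least `2 ^ (d + 1)`,
leaving at least `2 ^ d` choices. -/
theorem two_pow_le_card_linearIndependent {V : Type*} [AddCommGroup V] [Module (ZMod 2) V]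
    [Finite V] {t d : ℕ} (ht : t ≤ d + 1) (hd : d + 1 ≤ finrank (ZMod 2) V) :
    2 ^ (d * t) ≤ Nat.card {x : Fin t → V // LinearIndependent (ZMod 2) x} := by
  rw [card_linearIndependent (ht.trans hd), pow_mul]
  calc (2 ^ d) ^ t = ∏ _i : Fin t, 2 ^ d := by simp
    _ ≤ _ := by
      refine Finset.prod_le_prod' fun i _ => ?_
      rw [ZMod.card]
      have h1 : 2 ^ (d + 1) ≤ 2 ^ finrank (ZMod 2) V := Nat.pow_le_pow_right two_pos hd
      have h2 : 2 ^ i.1 ≤ 2 ^ d := Nat.pow_le_pow_right two_pos (by omega)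
      rw [pow_succ] at h1
      omega

/-- Double counting of pairs of a matrix `M` and an independent tuple in its left kernel. -/
theorem card_isotropic_ker_mul_le (G : Matrix ι ι (ZMod 2)) {s d : ℕ}
    (hd : d + 1 + n = Fintype.card ι) (hsd : s + s ≤ d + 1) :
    Nat.card {M : Matrix ι (Fin n) (ZMod 2) // ∀ L₁ L₂ : Matrix (Fin s) ι (ZMod 2),
      L₁ * M = 0 → L₂ * M = 0 → L₁ * G * L₂ᵀ = 0} * 2 ^ (d * (s + s)) ≤
    Nat.card {x : Matrix (Fin s) ι (ZMod 2) × Matrix (Fin s) ι (ZMod 2) //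
      x.1 * G * x.2ᵀ = 0} * 2 ^ (n * (Fintype.card ι - (s + s))) := by
  classical
  set I := {M : Matrix ι (Fin n) (ZMod 2) // ∀ L₁ L₂ : Matrix (Fin s) ι (ZMod 2),
      L₁ * M = 0 → L₂ * M = 0 → L₁ * G * L₂ᵀ = 0} with hI
  -- Of the isotropy of the left kernel, only the orthogonality of the first `s` rows of the tuple
  -- to the last `s` is retained.
  let J := {L : Matrix (Fin (s + s)) ι (ZMod 2) // L.rank = s + s ∧
    L.submatrix (Fin.castAdd s) id * G * (L.submatrix (Fin.natAdd s) id)ᵀ = 0}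
  let S : I → Type _ := fun M =>
    {x : Fin (s + s) → LinearMap.ker M.1ᵀ.mulVecLin // LinearIndependent (ZMod 2) x}
  let T : J → Type _ := fun L => {M : Matrix ι (Fin n) (ZMod 2) // L.1 * M = 0}
  have : Fintype I := Fintype.ofFinite I
  have : Fintype J := Fintype.ofFinite J
  have hcard : Nat.card (Σ M, S M) ≤ Nat.card (Σ L, T L) := by
    have hmul : ∀ (M : I) (x : S M),
        (Matrix.of fun i => (x.1 i : ι → ZMod 2) : Matrix (Fin (s + s)) ι (ZMod 2)) * M.1 = 0 := by
      intro M x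
      ext i j
      have := congrFun (LinearMap.mem_ker.1 (x.1 i).2) j
      rw [Matrix.mulVecLin_apply, Matrix.mulVec_transpose] at this
      exact this
    have hrank : ∀ (M : I) (x : S M),
        (Matrix.of fun i => (x.1 i : ι → ZMod 2) :
          Matrix (Fin (s + s)) ι (ZMod 2)).rank = s + s := by
      intro M x
      have hli : LinearIndependent (ZMod 2) (Matrix.of fun i => (x.1 i : ι → ZMod 2) :
          Matrix (Fin (s + s)) ι (ZMod 2)).row :=
        x.2.map' (LinearMap.ker M.1ᵀ.mulVecLin).subtype (Submodule.ker_subtype _)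
      simpa using hli.rank_matrix
    refine Nat.card_le_card_of_injective (fun x : Σ M, S M =>
      (⟨⟨Matrix.of fun i => (x.2.1 i : ι → ZMod 2), hrank x.1 x.2, ?_⟩, x.1.1,
        hmul x.1 x.2⟩ : Σ L, T L)) ?_
    · refine x.1.2 _ _ ?_ ?_
      · ext i j
        exact congrFun (congrFun (hmul x.1 x.2) (Fin.castAdd s i)) j
      · ext i j
        exact congrFun (congrFun (hmul x.1 x.2) (Fin.natAdd s i)) j
    · rintro ⟨M, x⟩ ⟨N, y⟩ h
      have h1 : M = N := Subtype.ext (congrArg (fun z : Σ L, T L => z.2.1) h)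
      subst h1
      have h2 := congrArg (fun z : Σ L, T L => z.1.1) h
      have h3 : x = y := by
        refine Subtype.ext (funext fun i => Subtype.ext (funext fun t => ?_))
        exact congrFun (congrFun h2 i) t
      rw [h3]
  rw [Nat.card_sigma, Nat.card_sigma] at hcard
  have hleft : Nat.card I * 2 ^ (d * (s + s)) ≤ ∑ M, Nat.card (S M) := by
    rw [Nat.card_eq_fintype_card, ← smul_eq_mul, ← Finset.card_univ]
    refine Finset.card_nsmul_le_sum _ _ _ fun M _ => two_pow_le_card_linearIndependent hsd ?_
    rw [finrank_ker_mulVecLin, Matrix.rank_transpose]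
    have := M.1.rank_le_card_width
    rw [Fintype.card_fin] at this
    omega
  have hright : ∑ L, Nat.card (T L) ≤
      Nat.card J * 2 ^ (n * (Fintype.card ι - (s + s))) := by
    rw [Nat.card_eq_fintype_card, ← smul_eq_mul, ← Finset.card_univ]
    refine Finset.sum_le_card_nsmul _ _ _ fun L _ => ?_
    rw [card_mul_eq_zero, L.2.1, Fintype.card_fin]
  refine hleft.trans (hcard.trans (hright.trans (Nat.mul_le_mul_right _ ?_)))
  refine Nat.card_le_card_of_injective (fun L : J =>
    ⟨(L.1.submatrix (Fin.castAdd s) id, L.1.submatrix (Fin.natAdd s) id), L.2.2⟩) ?_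
  intro L L' h
  have h1 := congrArg (fun z => z.1.1) h
  have h2 := congrArg (fun z => z.1.2) h
  refine Subtype.ext (Matrix.ext fun i j => ?_)
  induction i using Fin.addCases with
  | left i => exact congrFun (congrFun h1 i) j
  | right i => exact congrFun (congrFun h2 i) j

/-- For a fixed matrix `B` with sufficiently many rows, few matrices are of the form `B * A` with
`A` isotropic of full rank. -/
theorem card_mul_fullRankIsotropic_le (B : Matrix ι (Fin n ⊕ Fin n) (ZMod 2)) {u : ℕ}
    (hu : n + 2 * u ≤ Fintype.card ι) :
    (Nat.card {M : Matrix ι (Fin n) (ZMod 2) // ∃ A ∈ fullRankIsotropic n, M = B * A} : ℝ) ≤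
      2 ^ (n * Fintype.card ι) *
        ((1 / 2 : ℝ) ^ (n * u) + 2 ^ (2 * u + 1) * (1 / 2 : ℝ) ^ (u * u / 2)) := by
  classical
  set k := Fintype.card ι with hk
  -- If the rank deficit is at least `u`, the column space alone gives the saving `2 ^ (n * u)`;
  -- otherwise the form `G` has large rank.
  rcases le_or_gt (B.rank + u) k with hB | hB
  · have h1 : Nat.card {M : Matrix ι (Fin n) (ZMod 2) // ∃ A ∈ fullRankIsotropic n, M = B * A} ≤
        2 ^ (n * B.rank) := by
      have := card_range_mul_le (σ := Fin n) B
      rw [Fintype.card_fin] at this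
      exact le_trans (card_subtype_le_of_imp fun M ⟨A, _, h⟩ => ⟨A, h⟩) this
    have h2 : 2 ^ (n * B.rank) * 2 ^ (n * u) ≤ 2 ^ (n * k) := by
      rw [← pow_add, ← mul_add]
      exact Nat.pow_le_pow_right two_pos (Nat.mul_le_mul_left _ hB)
    have h3 : (Nat.card {M : Matrix ι (Fin n) (ZMod 2) //
        ∃ A ∈ fullRankIsotropic n, M = B * A} : ℝ) * 2 ^ (n * u) ≤ 2 ^ (n * k) := by
      exact_mod_cast (Nat.mul_le_mul_right _ h1).trans h2
    have h4 : (Nat.card {M : Matrix ι (Fin n) (ZMod 2) //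
        ∃ A ∈ fullRankIsotropic n, M = B * A} : ℝ) ≤ 2 ^ (n * k) * (1 / 2 : ℝ) ^ (n * u) := by
      rw [one_div, inv_pow, ← div_eq_mul_inv, le_div_iff₀ (by positivity)]
      exact h3
    refine h4.trans ?_
    gcongr
    exact le_add_of_nonneg_right (by positivity)
  · rcases Nat.eq_zero_or_pos u with rfl | hu0
    · have := B.rank_le_card_height
      omega
    obtain ⟨d, hd⟩ := Nat.exists_eq_add_of_le (show n + 1 ≤ k by omega)
    set G := B * sympMatrix n * Bᵀ with hG
    -- Sylvester gives `G.rank ≥ 2 * B.rank - 2 * n`, and `B.rank > k - u ≥ n + u`.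
    have hrank : 2 * u ≤ G.rank := by
      have h1 := rank_add_rank_le_rank_mul_add (B * sympMatrix n) Bᵀ
      rw [Matrix.rank_mul_eq_left_of_isUnit_det _ _ isUnit_det_sympMatrix,
        Matrix.rank_transpose, ← hG] at h1
      have h2 : Fintype.card (Fin n ⊕ Fin n) = n + n := by simp
      omega
    have h1 : Nat.card {M : Matrix ι (Fin n) (ZMod 2) // ∃ A ∈ fullRankIsotropic n, M = B * A} ≤
        Nat.card {M : Matrix ι (Fin n) (ZMod 2) // ∀ L₁ L₂ : Matrix (Fin u) ι (ZMod 2),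
          L₁ * M = 0 → L₂ * M = 0 → L₁ * G * L₂ᵀ = 0} := by
      refine card_subtype_le_of_imp ?_
      rintro _ ⟨A, hA, rfl⟩ L₁ L₂ h₁ h₂
      exact mul_mul_transpose_eq_zero B hA h₁ h₂
    have h2 := card_isotropic_ker_mul_le (n := n) G (s := u) (d := d) (by omega) (by omega)
    have h3 := card_pairs_le G u hrank
    set c := Nat.card {M : Matrix ι (Fin n) (ZMod 2) // ∃ A ∈ fullRankIsotropic n, M = B * A}
    rw [← hk] at h2 h3
    obtain ⟨e, he⟩ := Nat.exists_eq_add_of_le (show u + u ≤ k by omega)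
    have hke : k - (u + u) = e := by omega
    rw [hke] at h2
    -- In `2 * u + 1`, the `2 * u` is the factor two lost per vector when counting independent
    -- tuples, and the `1` comes from `card_pairs_le`.
    have h4 : c * 2 ^ (u * u / 2) * 2 ^ (d * (u + u)) ≤
        2 ^ (n * k + (2 * u + 1)) * 2 ^ (d * (u + u)) := by
      calc c * 2 ^ (u * u / 2) * 2 ^ (d * (u + u))
          = c * 2 ^ (d * (u + u)) * 2 ^ (u * u / 2) := by ring
        _ ≤ _ := Nat.mul_le_mul_right _ ((Nat.mul_le_mul_right _ h1).trans h2)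
        _ ≤ 2 ^ (2 * u * k + 1) * 2 ^ (n * e) := by
          rw [mul_right_comm]
          exact Nat.mul_le_mul_right _ h3
        _ = 2 ^ (n * k + (2 * u + 1)) * 2 ^ (d * (u + u)) := by
          rw [← pow_add, ← pow_add]
          congr 1
          have h5 : d + 1 + n = u + u + e := by omega
          have h6 : k = d + 1 + n := by omega
          have h7 : n * k = n * (u + u) + n * e := by rw [he]; ring
          rw [h7, h6]
          ring
    have h5 := Nat.le_of_mul_le_mul_right h4 (by positivity)
    have h6 : (c : ℝ) * 2 ^ (u * u / 2) ≤ 2 ^ (n * k) * 2 ^ (2 * u + 1) := by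
      rw [← pow_add]
      exact_mod_cast h5
    have h7 : (c : ℝ) ≤ 2 ^ (n * k) * (2 ^ (2 * u + 1) * (1 / 2 : ℝ) ^ (u * u / 2)) := by
      rw [one_div, inv_pow, ← mul_assoc, ← div_eq_mul_inv, le_div_iff₀ (by positivity)]
      exact h6
    refine h7.trans ?_
    gcongr
    exact le_add_of_nonneg_left (by positivity)

end Isotropic

/-! ### Symplectic weight and the bias of noisy parities -/

section Weight

variable {n : ℕ}

/-- The number of positions `j` in which the pair `(v_j, v_{j+n})` is nonzero. -/
def sympWeight (v : SympVec n) : ℕ :=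
  (Finset.univ.filter fun j => ¬(v (Sum.inl j) = 0 ∧ v (Sum.inr j) = 0)).card

theorem sum_prod_sympVec (g : Fin n → ZMod 2 → ZMod 2 → ℝ) :
    ∑ e : SympVec n, ∏ j, g j (e (Sum.inl j)) (e (Sum.inr j)) = ∏ j, ∑ x, ∑ y, g j x y := by
  let φ : SympVec n ≃ (Fin n → ZMod 2 × ZMod 2) :=
    { toFun := fun e j => (e (Sum.inl j), e (Sum.inr j))
      invFun := fun f => Sum.elim (fun j => (f j).1) (fun j => (f j).2)
      left_inv := fun e => by ext (j | j) <;> rfl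
      right_inv := fun f => rfl }
  have h := Finset.prod_univ_sum (fun _ : Fin n => (Finset.univ : Finset (ZMod 2 × ZMod 2)))
    (fun j x => g j x.1 x.2)
  simp only [Fintype.sum_prod_type, Fintype.piFinset_univ] at h
  rw [h]
  exact Fintype.sum_equiv φ _ _ fun e => rfl

theorem prod_ite_eq_pow_sympWeight (b : SympVec n) (x : ℝ) :
    ∏ j, (if b (Sum.inl j) = 0 ∧ b (Sum.inr j) = 0 then 1 else x) = x ^ sympWeight b := by
  rw [Finset.prod_ite, Finset.prod_const_one, one_mul, Finset.prod_const, sympWeight]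

theorem sum_pow_sympWeight (x : ℝ) :
    ∑ v : SympVec n, x ^ sympWeight v = (1 + 3 * x) ^ n := by
  simp_rw [← prod_ite_eq_pow_sympWeight]
  rw [sum_prod_sympVec fun _ a b => if a = 0 ∧ b = 0 then 1 else x]
  have h : ∑ a : ZMod 2, ∑ b : ZMod 2, (if a = 0 ∧ b = 0 then (1 : ℝ) else x) = 1 + 3 * x := by
    change ∑ a : Fin 2, ∑ b : Fin 2, (if a = 0 ∧ b = 0 then (1 : ℝ) else x) = 1 + 3 * x
    simp [Fin.sum_univ_two]
    ring
  simp [h]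

/-- The nontrivial real character of `ZMod 2`. -/
def signChar : AddChar (ZMod 2) ℝ where
  toFun x := if x = 0 then 1 else -1
  map_zero_eq_one' := by simp
  map_add_eq_mul' x y := by
    have h : ∀ x : ZMod 2, x = 0 ∨ x = 1 := by decide
    have h2 : (1 : ZMod 2) + 1 = 0 := by decide
    rcases h x with rfl | rfl <;> rcases h y with rfl | rfl <;> simp [h2]

theorem signChar_apply (x : ZMod 2) : signChar x = if x = 0 then 1 else -1 := rfl

theorem signChar_sum {ι : Type*} (s : Finset ι) (f : ι → ZMod 2) :
    signChar (∑ i ∈ s, f i) = ∏ i ∈ s, signChar (f i) := by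
  classical
  induction s using Finset.induction_on with
  | empty => simp
  | insert i s hi ih => rw [Finset.sum_insert hi, Finset.prod_insert hi, AddChar.map_add_eq_mul, ih]

/-- The Fourier transform factors over the pairs. A zero pair of `b` gives `1`; at a nonzero pair
the character sums to `-1` over the three errors, giving `1 - p - p / 3`. -/
theorem sum_depolarizingMass_mul_signChar (p : ℝ) (b : SympVec n) :
    ∑ e : SympVec n, depolarizingMass p e * signChar (b ⬝ᵥ e) =
      (1 - 4 * p / 3) ^ sympWeight b := by
  have h1 : ∀ e : SympVec n, depolarizingMass p e * signChar (b ⬝ᵥ e) =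
      ∏ j, (if e (Sum.inl j) = 0 ∧ e (Sum.inr j) = 0 then 1 - p else p / 3) *
        signChar (b (Sum.inl j) * e (Sum.inl j) + b (Sum.inr j) * e (Sum.inr j)) := by
    intro e
    rw [Finset.prod_mul_distrib, depolarizingMass, ← signChar_sum, dotProduct,
      Fintype.sum_sum_type, Finset.sum_add_distrib]
  simp_rw [h1]
  rw [sum_prod_sympVec fun j x y => (if x = 0 ∧ y = 0 then 1 - p else p / 3) *
        signChar (b (Sum.inl j) * x + b (Sum.inr j) * y), ← prod_ite_eq_pow_sympWeight]
  refine Finset.prod_congr rfl fun j _ => ?_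
  have h : ∀ x : ZMod 2, x = 0 ∨ x = 1 := by decide
  have h2 : (1 : ZMod 2) + 1 = 0 := by decide
  have hs : ∀ f : ZMod 2 → ℝ, ∑ x, f x = f 0 + f 1 := fun f => Fin.sum_univ_two f
  simp only [hs, signChar_apply]
  rcases h (b (Sum.inl j)) with h3 | h3 <;> rcases h (b (Sum.inr j)) with h4 | h4 <;>
    simp [h3, h4, h2] <;> ring

theorem sum_depolarizingMass (p : ℝ) : ∑ e : SympVec n, depolarizingMass p e = 1 := by
  have h := sum_depolarizingMass_mul_signChar p (0 : SympVec n)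
  simpa [sympWeight] using h

theorem expectedWeight_eq {m : ℕ} (p : ℝ) (B : Matrix (Fin m) (Fin n ⊕ Fin n) (ZMod 2)) :
    expectedWeight p B = ∑ i, (1 - (1 - 4 * p / 3) ^ sympWeight (B i)) / 2 := by
  have h1 : ∀ e : SympVec n, (hammingNorm (B *ᵥ e) : ℝ) = ∑ i, (1 - signChar (B i ⬝ᵥ e)) / 2 := by
    intro e
    rw [hammingNorm, Finset.card_filter]
    push_cast
    refine Finset.sum_congr rfl fun i _ => ?_
    rw [signChar_apply]
    change (if B i ⬝ᵥ e ≠ 0 then (1 : ℝ) else 0) = _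
    by_cases h : B i ⬝ᵥ e = 0 <;> simp [h]
  simp_rw [expectedWeight, h1, Finset.mul_sum]
  rw [Finset.sum_comm]
  refine Finset.sum_congr rfl fun i _ => ?_
  have h2 : 1 - ∑ e : SympVec n, depolarizingMass p e * signChar (B i ⬝ᵥ e) =
      ∑ e : SympVec n, (depolarizingMass p e - depolarizingMass p e * signChar (B i ⬝ᵥ e)) := by
    rw [Finset.sum_sub_distrib, sum_depolarizingMass]
  rw [← sum_depolarizingMass_mul_signChar, h2, Finset.sum_div]
  refine Finset.sum_congr rfl fun e _ => ?_
  ring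

/-- The base is negative for `p > 3/4`, hence the absolute value: `|1 - 4p/3| ≤ 1 - 2p/3` on all of
`(0, 1)`. -/
theorem pow_sympWeight_le {p w : ℝ} (hp : 0 < p) (hp1 : p < 1) {v : SympVec n}
    (hv : w ≤ sympWeight v) :
    (1 - 4 * p / 3) ^ sympWeight v ≤ Real.exp (-(2 * p / 3 * w)) := by
  have h1 : |1 - 4 * p / 3| ≤ Real.exp (-(2 * p / 3)) := by
    refine le_trans ?_ (Real.add_one_le_exp _)
    rw [abs_le]
    constructor <;> linarith
  calc (1 - 4 * p / 3) ^ sympWeight v ≤ |1 - 4 * p / 3| ^ sympWeight v := by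
        rw [← abs_pow]
        exact le_abs_self _
    _ ≤ Real.exp (-(2 * p / 3)) ^ sympWeight v := by gcongr
    _ = Real.exp (-(2 * p / 3 * sympWeight v)) := by
        rw [← Real.exp_nat_mul]
        congr 1
        ring
    _ ≤ _ := by gcongr

/-- If few rows of `B` have symplectic weight less than `w`, the expected weight is large. -/
theorem le_expectedWeight {m : ℕ} {p w : ℝ} (hp : 0 < p) (hp1 : p < 1)
    (B : Matrix (Fin m) (Fin n ⊕ Fin n) (ZMod 2)) :
    ((m : ℝ) - Nat.card {i // (sympWeight (B i) : ℝ) < w}) *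
      ((1 - Real.exp (-(2 * p / 3 * w))) / 2) ≤ expectedWeight p B := by
  classical
  rw [expectedWeight_eq]
  have h1 : ((m : ℝ) - Nat.card {i // (sympWeight (B i) : ℝ) < w}) *
      ((1 - Real.exp (-(2 * p / 3 * w))) / 2) =
      ∑ i, if (sympWeight (B i) : ℝ) < w then 0 else
        (1 - Real.exp (-(2 * p / 3 * w))) / 2 := by
    rw [Finset.sum_ite, Finset.sum_const_zero, zero_add, Finset.sum_const, nsmul_eq_mul,
      Nat.card_eq_fintype_card, Fintype.card_subtype]
    congr 1
    have := Finset.card_filter_add_card_filter_not (s := (Finset.univ : Finset (Fin m)))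
      (fun i => (sympWeight (B i) : ℝ) < w)
    rw [Finset.card_univ, Fintype.card_fin] at this
    rw [sub_eq_iff_eq_add']
    exact_mod_cast this.symm
  rw [h1]
  refine Finset.sum_le_sum fun i _ => ?_
  split_ifs with h
  · have h2 := pow_sympWeight_le hp hp1 (w := 0) (v := B i) (by positivity)
    rw [mul_zero, neg_zero, Real.exp_zero] at h2
    linarith
  · have h2 := pow_sympWeight_le hp hp1 (not_lt.1 h)
    linarith

/-- There are few vectors of small symplectic weight. -/
theorem exists_card_sympWeight_lt_le {h : ℝ} (hh : 0 < h) :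
    ∃ ε : ℝ, 0 < ε ∧ ∀ n : ℕ,
      (Nat.card {v : SympVec n // (sympWeight v : ℝ) < ε * n} : ℝ) ≤ Real.exp (h * n) := by
  classical
  -- Chernoff bound: `x` is chosen so that `1 + 3 * x ≤ exp (h / 2)`, and then `ε` so that `x ^ (ε *
  -- n) = exp (-(h / 2) * n)`.
  set x : ℝ := min (h / 6) (1 / 2) with hx
  have hx0 : 0 < x := by positivity
  have hx1 : x < 1 := (min_le_right _ _).trans_lt (by norm_num)
  have hxh : x ≤ h / 6 := min_le_left _ _
  have hl : Real.log x < 0 := Real.log_neg hx0 hx1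
  refine ⟨h / 2 / (-Real.log x), div_pos (by positivity) (by linarith), fun n => ?_⟩
  set w : ℝ := h / 2 / (-Real.log x) * n with hw
  have h1 : (Nat.card {v : SympVec n // (sympWeight v : ℝ) < w} : ℝ) * Real.exp (-(h / 2 * n)) ≤
      ∑ v : SympVec n, x ^ sympWeight v := by
    rw [Nat.card_eq_fintype_card, Fintype.card_subtype, ← nsmul_eq_mul]
    refine (Finset.card_nsmul_le_sum _ (fun v => x ^ sympWeight v) _ fun v hv => ?_).trans
      (Finset.sum_le_univ_sum_of_nonneg fun v => by positivity)
    rw [Finset.mem_filter] at hv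
    have h2 : -(h / 2 * n) = w * Real.log x := by
      rw [hw]
      field_simp [hl.ne]
    rw [h2, ← Real.exp_log hx0, ← Real.exp_nat_mul, Real.exp_log hx0]
    apply Real.exp_le_exp.2
    nlinarith [hv.2]
  rw [sum_pow_sympWeight, Real.exp_neg, ← div_eq_mul_inv, div_le_iff₀ (Real.exp_pos _)] at h1
  refine h1.trans ?_
  calc (1 + 3 * x) ^ n * Real.exp (h / 2 * n)
      ≤ Real.exp (h / 2) ^ n * Real.exp (h / 2 * n) := by
        gcongr
        have := Real.add_one_le_exp (h / 2)
        linarith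
    _ = Real.exp (h * n) := by
        rw [← Real.exp_nat_mul, ← Real.exp_add]
        congr 1
        ring

end Weight

/-! ### Union bound over the low-weight rows -/

section Union

/-- Union bound over the rows of small symplectic weight. -/
theorem card_lowWeight_product_le {m n u : ℕ} (w : ℝ) :
    (Nat.card {M : Matrix (Fin m) (Fin n) (ZMod 2) //
      ∃ B : Matrix (Fin m) (Fin n ⊕ Fin n) (ZMod 2),
        n + 2 * u ≤ Nat.card {i // (sympWeight (B i) : ℝ) < w} ∧
        ∃ A ∈ fullRankIsotropic n, M = B * A} : ℝ) ≤
      ((Nat.card {v : SympVec n // (sympWeight v : ℝ) < w} : ℝ) + 1) ^ m *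
        (2 ^ (n * m) *
          ((1 / 2 : ℝ) ^ (n * u) + 2 ^ (2 * u + 1) * (1 / 2 : ℝ) ^ (u * u / 2))) := by
  classical
  set X : ℝ := (1 / 2 : ℝ) ^ (n * u) + 2 ^ (2 * u + 1) * (1 / 2 : ℝ) ^ (u * u / 2) with hX
  let low := {v : SympVec n // (sympWeight v : ℝ) < w}
  let rows : (f : Fin m → Option low) → Matrix {i // (f i).isSome} (Fin n ⊕ Fin n) (ZMod 2) :=
    fun f i => ((f i.1).get i.2).1
  -- A pattern `f` records the low-weight rows of `B` and their positions, with `none` elsewhere.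
  -- Rows of `M` at `none` are left arbitrary, so every pattern gets the same bound `2 ^ (n * m) *
  -- X`.
  let I := {f : Fin m → Option low // n + 2 * u ≤ Fintype.card {i // (f i).isSome}}
  let T : I → Type := fun f => {M : Matrix (Fin m) (Fin n) (ZMod 2) //
    ∃ A ∈ fullRankIsotropic n, M.submatrix (Subtype.val : {i // (f.1 i).isSome} → Fin m) id =
      rows f.1 * A}
  have : Fintype I := Fintype.ofFinite I
  have hT : ∀ f : I, (Nat.card (T f) : ℝ) ≤ 2 ^ (n * m) * X := by
    intro f
    have h1 : Nat.card (T f) ≤ Nat.card ({M : Matrix {i // (f.1 i).isSome} (Fin n) (ZMod 2) //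
        ∃ A ∈ fullRankIsotropic n, M = rows f.1 * A} ×
        Matrix {i // ¬ (f.1 i).isSome} (Fin n) (ZMod 2)) := by
      refine Nat.card_le_card_of_injective (fun M =>
        (⟨M.1.submatrix Subtype.val id, M.2⟩, M.1.submatrix Subtype.val id)) ?_
      intro M N h
      have h2 := congrArg (fun z => z.1.1) h
      have h3 := congrArg (fun z => z.2) h
      refine Subtype.ext (Matrix.ext fun i j => ?_)
      by_cases hi : (f.1 i).isSome
      · exact congrFun (congrFun h2 ⟨i, hi⟩) j
      · exact congrFun (congrFun h3 ⟨i, hi⟩) j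
    have h2 : Nat.card (Matrix {i // ¬ (f.1 i).isSome} (Fin n) (ZMod 2)) =
        2 ^ (n * Fintype.card {i // ¬ (f.1 i).isSome}) := by
      simp [Matrix, ← pow_mul]
    rw [Nat.card_prod, h2] at h1
    have h3 := card_mul_fullRankIsotropic_le (rows f.1) f.2
    have h4 : Fintype.card {i // (f.1 i).isSome} + Fintype.card {i // ¬ (f.1 i).isSome} = m := by
      rw [Fintype.card_subtype_compl, Fintype.card_fin]
      have := Fintype.card_subtype_le fun i => ((f.1 i).isSome : Prop)
      rw [Fintype.card_fin] at this
      omega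
    calc (Nat.card (T f) : ℝ) ≤ _ := Nat.cast_le.2 h1
      _ ≤ 2 ^ (n * Fintype.card {i // (f.1 i).isSome}) * X *
          2 ^ (n * Fintype.card {i // ¬ (f.1 i).isSome}) := by
        push_cast
        gcongr
      _ = 2 ^ (n * m) * X := by
        rw [mul_right_comm, ← pow_add, ← mul_add, h4]
  have hex : ∀ M : {M : Matrix (Fin m) (Fin n) (ZMod 2) //
      ∃ B : Matrix (Fin m) (Fin n ⊕ Fin n) (ZMod 2),
        n + 2 * u ≤ Nat.card {i // (sympWeight (B i) : ℝ) < w} ∧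
        ∃ A ∈ fullRankIsotropic n, M = B * A}, ∃ f : I, ∃ A ∈ fullRankIsotropic n,
        M.1.submatrix (Subtype.val : {i // (f.1 i).isSome} → Fin m) id = rows f.1 * A := by
    rintro ⟨_, B, hB, A, hA, rfl⟩
    let f : Fin m → Option low := fun i =>
      if h : (sympWeight (B i) : ℝ) < w then some ⟨B i, h⟩ else none
    have hf : ∀ i, (f i).isSome ↔ (sympWeight (B i) : ℝ) < w := by
      intro i
      by_cases h : (sympWeight (B i) : ℝ) < w <;> simp [f, h]
    refine ⟨⟨f, ?_⟩, A, hA, ?_⟩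
    · rw [← Nat.card_eq_fintype_card, Nat.card_congr (Equiv.subtypeEquivRight hf)]
      exact hB
    · have : rows f = B.submatrix Subtype.val id := by
        ext ⟨i, hi⟩ t
        have h := (hf i).1 hi
        simp [rows, f, h]
      rw [this]
      rfl
  choose F hF using hex
  have hinj : Function.Injective (fun M => (⟨F M, M.1, hF M⟩ : Σ f, T f)) := by
    intro M N h
    have : (fun x : Σ f, T f => x.2.1) ⟨F M, M.1, hF M⟩ =
        (fun x : Σ f, T f => x.2.1) ⟨F N, N.1, hF N⟩ := by
      rw [show (⟨F M, M.1, hF M⟩ : Σ f, T f) = ⟨F N, N.1, hF N⟩ from h]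
    exact Subtype.ext this
  refine (Nat.cast_le.2 (Nat.card_le_card_of_injective _ hinj)).trans ?_
  rw [Nat.card_sigma]
  push_cast
  refine (Finset.sum_le_card_nsmul _ _ _ fun f _ => hT f).trans ?_
  rw [nsmul_eq_mul]
  gcongr
  rw [Finset.card_univ, ← Nat.card_eq_fintype_card]
  have h5 : Nat.card I ≤ (Nat.card low + 1) ^ m := by
    refine (Finite.card_subtype_le _).trans ?_
    simp
  exact_mod_cast h5

end Union

/-! ### Event probabilities and total variation -/

section Probability

variable {α : Type*} [Fintype α]

theorem prob_eq_sum (P : PMF α) (E : Set α) :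
    prob P E = ∑ x, E.indicator (fun x => (P x).toReal) x := by
  rw [prob, PMF.toOuterMeasure_apply_fintype, ENNReal.toReal_sum]
  · refine Finset.sum_congr rfl fun x _ => ?_
    by_cases h : x ∈ E <;> simp [h]
  · intro x _
    by_cases h : x ∈ E <;> simp [h, P.apply_ne_top]

omit [Fintype α] in
theorem prob_univ (P : PMF α) : prob P Set.univ = 1 := by
  have : P.toOuterMeasure Set.univ = 1 :=
    (PMF.toOuterMeasure_apply_eq_one_iff P _).2 (Set.subset_univ _)
  simp [prob, this]

theorem prob_add_prob_compl (P : PMF α) (E : Set α) : prob P E + prob P Eᶜ = 1 := by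
  rw [← prob_univ P, prob_eq_sum, prob_eq_sum, prob_eq_sum, ← Finset.sum_add_distrib]
  refine Finset.sum_congr rfl fun x _ => ?_
  rw [Set.indicator_univ]
  exact congrFun (Set.indicator_self_add_compl E fun x => (P x).toReal) x

omit [Fintype α] in
theorem prob_nonneg (P : PMF α) (E : Set α) : 0 ≤ prob P E := ENNReal.toReal_nonneg

/-- Summing the absolute differences over all points loses a factor two, harmless for negligibility.
-/
theorem prob_le_prob_add_tvDist (P Q : PMF α) (E : Set α) :
    prob P E ≤ prob Q E + 2 * tvDist P Q := by
  rw [prob_eq_sum, prob_eq_sum, tvDist, ← mul_assoc, mul_one_div_cancel two_ne_zero, one_mul,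
    ← Finset.sum_add_distrib]
  refine Finset.sum_le_sum fun x _ => ?_
  by_cases h : x ∈ E
  · simp only [Set.indicator_of_mem h]
    linarith [le_abs_self ((P x).toReal - (Q x).toReal)]
  · simp [h]

theorem prob_uniformOfFintype [Nonempty α] (E : Set α) :
    prob (PMF.uniformOfFintype α) E = (Nat.card E : ℝ) / Nat.card α := by
  classical
  rw [prob, PMF.toOuterMeasure_uniformOfFintype_apply]
  simp [Nat.card_eq_fintype_card]

/-- Given `B ∈ E`, the product lies in `T` with probability one. -/
theorem prob_le_prob_productLaw {m n : ℕ} (P : PMF (Matrix (Fin m) (Fin n ⊕ Fin n) (ZMod 2)))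
    {E : Set (Matrix (Fin m) (Fin n ⊕ Fin n) (ZMod 2))}
    {T : Set (Matrix (Fin m) (Fin n) (ZMod 2))}
    (h : ∀ B ∈ E, ∀ A ∈ fullRankIsotropic n, B * A ∈ T) :
    prob P E ≤ prob (productLaw P) T := by
  refine ENNReal.toReal_mono ?_ ?_
  · rw [PMF.toOuterMeasure_apply]
    exact PMF.tsum_coe_indicator_ne_top _ _
  · rw [productLaw, PMF.toOuterMeasure_bind_apply, PMF.toOuterMeasure_apply]
    refine ENNReal.tsum_le_tsum fun B => ?_
    by_cases hB : B ∈ E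
    · rw [Set.indicator_of_mem hB, (PMF.toOuterMeasure_apply_eq_one_iff _ _).2, mul_one]
      intro M hM
      rw [PMF.support_map, randomIsotropic, PMF.support_map] at hM
      obtain ⟨_, ⟨A, -, rfl⟩, rfl⟩ := hM
      exact h B hB A.1 A.2
    · simp [hB]

end Probability

/-! ### Asymptotic estimates -/

section Asymptotic

theorem one_half_pow_le_exp (q : ℕ) : (1 / 2 : ℝ) ^ q ≤ Real.exp (-(q / 2)) := by
  have h : (1 / 2 : ℝ) ≤ Real.exp (-(1 / 2)) := by
    linarith [Real.add_one_le_exp (-(1 / 2) : ℝ)]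
  calc (1 / 2 : ℝ) ^ q ≤ Real.exp (-(1 / 2)) ^ q := by gcongr
    _ = Real.exp (-(q / 2)) := by
      rw [← Real.exp_nat_mul]
      congr 1
      ring

theorem two_pow_le_exp (q : ℕ) : (2 : ℝ) ^ q ≤ Real.exp q := by
  have h : (2 : ℝ) ≤ Real.exp 1 := by linarith [Real.add_one_le_exp (1 : ℝ)]
  calc (2 : ℝ) ^ q ≤ Real.exp 1 ^ q := by gcongr
    _ = Real.exp q := by rw [← Real.exp_nat_mul, mul_one]

/-- With `u ≈ δm/4`, the cost `δ²nm/128` is beaten by `nu/2 ≈ δnm/8` and by `u²/4 ≈ δ²m²/64 ≥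
δ²nm/64`. The hypothesis `1000 ≤ δ²n` absorbs the terms linear in `m`. -/
theorem union_bound_le_exp {δ ℓ : ℝ} {n m : ℕ} (hδ : 0 < δ) (hδ1 : δ ≤ 1) (hℓ0 : 0 ≤ ℓ)
    (hℓ : ℓ ≤ Real.exp (δ ^ 2 / 128 * n)) (hnm : (n : ℝ) ≤ m)
    (hn : 1000 ≤ δ ^ 2 * n) :
    (ℓ + 1) ^ m * ((1 / 2 : ℝ) ^ (n * ⌊δ * m / 4⌋₊) +
      2 ^ (2 * ⌊δ * m / 4⌋₊ + 1) * (1 / 2 : ℝ) ^ (⌊δ * m / 4⌋₊ * ⌊δ * m / 4⌋₊ / 2)) ≤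
      2 * Real.exp (-n) := by
  set u := ⌊δ * m / 4⌋₊ with hu
  have hn0 : (0 : ℝ) ≤ n := n.cast_nonneg
  have hm0 : (0 : ℝ) ≤ m := m.cast_nonneg
  have hδn : δ ^ 2 * n ≤ δ * n := by
    gcongr
    nlinarith
  have hu1 : (u : ℝ) ≤ δ * m / 4 := Nat.floor_le (by positivity)
  have hu2 : δ * m / 4 - 1 ≤ u := by linarith [Nat.lt_floor_add_one (δ * m / 4)]
  have hδm : δ * m ≤ m := by nlinarith
  have hA : (ℓ + 1) ^ m ≤ Real.exp (m + δ ^ 2 / 128 * n * m) := by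
    have h1 : 1 ≤ Real.exp (δ ^ 2 / 128 * n) := Real.one_le_exp (by positivity)
    have h2 : (2 : ℝ) ≤ Real.exp 1 := by linarith [Real.add_one_le_exp (1 : ℝ)]
    calc (ℓ + 1) ^ m ≤ (Real.exp 1 * Real.exp (δ ^ 2 / 128 * n)) ^ m := by
          gcongr
          nlinarith
      _ = Real.exp (m + δ ^ 2 / 128 * n * m) := by
          rw [← Real.exp_add, ← Real.exp_nat_mul]
          congr 1
          ring
  have hnm' : δ ^ 2 * n * m ≤ δ * n * m := by gcongr
  have hB : (ℓ + 1) ^ m * (1 / 2 : ℝ) ^ (n * u) ≤ Real.exp (-n) := by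
    calc (ℓ + 1) ^ m * (1 / 2 : ℝ) ^ (n * u) ≤
        Real.exp (m + δ ^ 2 / 128 * n * m) * Real.exp (-((n * u : ℕ) / 2)) := by
          gcongr
          exact one_half_pow_le_exp _
      _ ≤ Real.exp (-n) := by
          rw [← Real.exp_add]
          apply Real.exp_le_exp.2
          push_cast
          have h3 : (n : ℝ) * (δ * m / 4 - 1) ≤ n * u := by gcongr
          have h4 : 1000 * (m : ℝ) ≤ δ * n * m := by
            gcongr
            linarith
          nlinarith
  have hC : (ℓ + 1) ^ m * (2 ^ (2 * u + 1) * (1 / 2 : ℝ) ^ (u * u / 2)) ≤ Real.exp (-n) := by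
    calc (ℓ + 1) ^ m * (2 ^ (2 * u + 1) * (1 / 2 : ℝ) ^ (u * u / 2)) ≤
        Real.exp (m + δ ^ 2 / 128 * n * m) *
          (Real.exp ((2 * u + 1 : ℕ)) * Real.exp (-((u * u / 2 : ℕ) / 2))) := by
          gcongr
          · exact two_pow_le_exp _
          · exact one_half_pow_le_exp _
      _ ≤ Real.exp (-n) := by
          rw [← Real.exp_add, ← Real.exp_add]
          apply Real.exp_le_exp.2
          have h5 : (u * u : ℝ) ≤ 2 * (u * u / 2 : ℕ) + 1 := by
            have : u * u ≤ 2 * (u * u / 2) + 1 := by omega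
            exact_mod_cast this
          have h6 : (δ * m / 4) * (δ * m / 4) - δ * m / 2 ≤ u * u := by
            have h7 : (δ * m / 4) ≤ u + 1 := by linarith
            have h8 : (δ * m / 4) * (δ * m / 4) ≤ (u + 1) * (u + 1) := by gcongr
            nlinarith
          have h9 : δ ^ 2 * n * m ≤ δ ^ 2 * m * m := by gcongr
          have h10 : 1000 * (m : ℝ) ≤ δ ^ 2 * m * m := by
            refine le_trans ?_ h9
            gcongr
          have h11 : 1000 ≤ (n : ℝ) := by nlinarith
          push_cast
          nlinarith
  rw [mul_add]
  linarith

theorem negligible_two_mul_exp_neg : Negligible fun n => 2 * Real.exp (-n) := by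
  have h : Negligible fun n => Real.exp (-n) := fun k =>
    (Real.tendsto_pow_mul_exp_neg_atTop_nhds_zero k).comp tendsto_natCast_atTop_atTop
  exact h.const_mul 2

/-- The noise parameter is eventually large compared with `1 / n`. -/
theorem eventually_exp_le {p : ℕ → ℝ} (hp_pos : ∀ n, 0 < p n)
    (hp : (fun n : ℕ => 1 / (n : ℝ)) =o[atTop] p) {ε η : ℝ} (hε : 0 < ε) (hη : 0 < η) :
    ∀ᶠ n : ℕ in atTop, Real.exp (-(2 * p n / 3 * (ε * n))) ≤ η := by
  -- The little-o bound with constant `2ε/(3K)` says exactly that `2pεn/3 ≥ K`.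
  set K : ℝ := |Real.log η| + 1 with hK
  have hK0 : 0 < K := by positivity
  filter_upwards [hp.bound (show 0 < 2 * ε / (3 * K) by positivity), eventually_gt_atTop 0]
    with n hn hn0
  have hn0' : (0 : ℝ) < n := Nat.cast_pos.2 hn0
  rw [Real.norm_of_nonneg (by positivity), Real.norm_of_nonneg (hp_pos n).le, div_mul_eq_mul_div,
    div_le_div_iff₀ hn0' (by positivity)] at hn
  rw [← Real.le_log_iff_exp_le hη]
  have := neg_abs_le (Real.log η)
  linarith

/-- Few rows of small symplectic weight force a large expected weight. -/
theorem card_lowWeight_of_expectedWeight_lt {n m : ℕ} {p δ w : ℝ} (hp : 0 < p) (hp1 : p < 1)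
    (hδ : 0 < δ) (hm : 0 < m) (hη : Real.exp (-(2 * p / 3 * w)) ≤ δ / 2)
    {B : Matrix (Fin m) (Fin n ⊕ Fin n) (ZMod 2)}
    (hB : expectedWeight p B < (1 - (n : ℝ) / m - δ) / 2 * m) :
    n + 2 * ⌊δ * m / 4⌋₊ ≤ Nat.card {i // (sympWeight (B i) : ℝ) < w} := by
  have hm' : (0 : ℝ) < m := Nat.cast_pos.2 hm
  have h1 := (le_expectedWeight hp hp1 (w := w) B).trans_lt hB
  set k := Nat.card {i // (sympWeight (B i) : ℝ) < w} with hk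
  set η := Real.exp (-(2 * p / 3 * w)) with hη'
  have h2 : (1 - (n : ℝ) / m - δ) / 2 * m = (m - n - δ * m) / 2 := by
    field_simp
  rw [h2] at h1
  have hη0 : 0 < η := Real.exp_pos _
  have h3 : (⌊δ * m / 4⌋₊ : ℝ) ≤ δ * m / 4 := Nat.floor_le (by positivity)
  have hk0 : (0 : ℝ) ≤ k := k.cast_nonneg
  -- From `(m - k)(1 - η) < m - n - δm` and `η ≤ δ/2` follows `k > n + δm/2`.
  have h4 : (n : ℝ) + 2 * ⌊δ * m / 4⌋₊ ≤ k := by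
    have h5 : η * m ≤ δ / 2 * m := by gcongr
    have h6 : 0 ≤ η * k := by positivity
    nlinarith
  exact_mod_cast h4

end Asymptotic

end SympLPN

theorem mainTheorem10
    (m : ℕ → ℕ) (c : ℝ) (p : ℕ → ℝ)
    (hm_poly : ∃ k : ℕ, (fun n : ℕ => (m n : ℝ)) =O[atTop] (fun n : ℕ => (n : ℝ) ^ k))
    (hc : 1 < c)
    (hm : ∀ᶠ n : ℕ in atTop, c * (n : ℝ) < (m n : ℝ))
    (hp_mem : ∀ n, 0 < p n ∧ p n < 1)
    (hp : (fun n : ℕ => 1 / (n : ℝ)) =o[atTop] p)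
    (B : ∀ n : ℕ, PMF (Matrix (Fin (m n)) (Fin n ⊕ Fin n) (ZMod 2)))
    (hB : SympLPN.Negligible fun n =>
      SympLPN.tvDist (SympLPN.productLaw (B n))
        (PMF.uniformOfFintype (Matrix (Fin (m n)) (Fin n) (ZMod 2))))
    (δ : ℝ) (hδ : 0 < δ) :
    ∃ ν : ℕ → ℝ, SympLPN.Negligible ν ∧
      ∀ n : ℕ, 1 - ν n ≤
        SympLPN.prob (B n)
          {b | (1 - (n : ℝ) / (m n : ℝ) - δ) / 2 * (m n : ℝ) ≤
            SympLPN.expectedWeight (p n) b} := by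
  open SympLPN in
  set E : ∀ n, Set (Matrix (Fin (m n)) (Fin n ⊕ Fin n) (ZMod 2)) := fun n =>
    {b | (1 - (n : ℝ) / (m n : ℝ) - δ) / 2 * (m n : ℝ) ≤ expectedWeight (p n) b} with hE
  -- Taking the exact failure probability as `ν` gives the bound for every `n`; only negligibility
  -- then needs large `n`.
  refine ⟨fun n => prob (B n) (E n)ᶜ, ?_, fun n => ?_⟩
  swap
  · have := prob_add_prob_compl (B n) (E n)
    exact (sub_eq_iff_eq_add.2 this.symm).le
  -- Failure for `δ` implies failure for the smaller `γ`, so the slack may be assumed at most `1`.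
  set γ : ℝ := min δ 1 with hγ
  have hγ0 : 0 < γ := by positivity
  have hγ1 : γ ≤ 1 := min_le_right _ _
  obtain ⟨ε, hε, hlow⟩ := exists_card_sympWeight_lt_le (show 0 < γ ^ 2 / 128 by positivity)
  refine SuperpolynomialDecay.trans_eventually_abs_le
    (negligible_two_mul_exp_neg.add (hB.const_mul 2)) ?_
  filter_upwards [hm, eventually_exp_le (fun n => (hp_mem n).1) hp hε (half_pos hγ0),
    eventually_ge_atTop ⌈1000 / γ ^ 2⌉₊, eventually_gt_atTop 0] with n hmn hexp hn hn0
  have hn0' : (0 : ℝ) < n := Nat.cast_pos.2 hn0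
  have hnm : (n : ℝ) < m n := by nlinarith
  have hm0 : 0 < m n := Nat.cast_pos.1 (hn0'.trans hnm)
  have hn1 : 1000 ≤ γ ^ 2 * n := by
    have := (div_le_iff₀ (by positivity)).1 (Nat.ceil_le.1 hn)
    linarith
  -- Quantifying `B` existentially makes this an event about the product alone, which can be tested
  -- against the uniform law.
  set T : Set (Matrix (Fin (m n)) (Fin n) (ZMod 2)) := {M |
    ∃ B : Matrix (Fin (m n)) (Fin n ⊕ Fin n) (ZMod 2),
      n + 2 * ⌊γ * m n / 4⌋₊ ≤ Nat.card {i // (sympWeight (B i) : ℝ) < ε * n} ∧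
      ∃ A ∈ fullRankIsotropic n, M = B * A} with hT
  have h1 : prob (B n) (E n)ᶜ ≤ prob (productLaw (B n)) T := by
    refine prob_le_prob_productLaw _ fun b hb A hA => ⟨b, ?_, A, hA, rfl⟩
    refine card_lowWeight_of_expectedWeight_lt (hp_mem n).1 (hp_mem n).2 hγ0 hm0 hexp ?_
    rw [hE, Set.mem_compl_iff, Set.mem_ofPred_eq, not_le] at hb
    refine hb.trans_le ?_
    gcongr
    exact min_le_left _ _
  have h2 := prob_le_prob_add_tvDist (productLaw (B n))
    (PMF.uniformOfFintype (Matrix (Fin (m n)) (Fin n) (ZMod 2))) T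
  have h3 : prob (PMF.uniformOfFintype (Matrix (Fin (m n)) (Fin n) (ZMod 2))) T ≤
      2 * Real.exp (-n) := by
    have hcard : Nat.card (Matrix (Fin (m n)) (Fin n) (ZMod 2)) = 2 ^ (n * m n) := by
      simp [Matrix, ← pow_mul]
    rw [prob_uniformOfFintype, hcard]
    push_cast
    rw [div_le_iff₀ (by positivity)]
    refine (card_lowWeight_product_le _).trans ?_
    have h4 := union_bound_le_exp hγ0 hγ1 (Nat.cast_nonneg _) (hlow n) hnm.le hn1
    calc _ = _ := by rw [mul_left_comm]
      _ ≤ 2 ^ (n * m n) * (2 * Real.exp (-n)) := by gcongr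
      _ = _ := mul_comm _ _
  rw [Function.comp_apply, Function.comp_apply, abs_of_nonneg (prob_nonneg _ _)]
  refine le_trans ?_ (le_abs_self _)
  rw [Pi.add_apply]
  linarith
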